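/- Let $X$ be a compact one-dimensional complex manifold and let $S\subset X$ be a finite Riemann surface, that is, a nonempty open subset containing no connected component of $X$, such that $\partial S=\partial(\overline S)$ and $\partial S$ is the union of finitely many pairwise disjoint simple closed analytic curves ($X$ and $S$ need not be connected). Here a simple closed analytic curve is the image of the unit circle under an injective holomorphic map of an open neighbourhood of the circle into $X$. Let $H$ be a complex Hilbert space of any dimension, for example $\mathbb C^d$ or $\ell^2$, with open unit ball $\mathbb B$ and unit sphere $\partial\mathbb B$, and let $f:S\to\mathbb B$ be a holomorphic map. (1) Let $x_0\in\partial S$. If $f$ extends to a $C^1$ map on $S\cup\{x_0\}$ with $f(x_0)\in\partial\mathbb B$, then $f(S)$ meets $\partial\mathbb B$ transversally at $f(x_0)$: the derivative $df_{x_0}:T_{x_0}X\to H$ of the extension exists as a complex linear map and $\langle f(x_0),df_{x_0}(v)\rangle\neq0$ for every nonzero $v\in T_{x_0}X$. (In a local parameter $z$ at $x_0$, this says $\langle f(x_0),\tfrac{df}{dz}(x_0)\rangle\ne0$.) (2) Consequently transversality need not be assumed for maps that are $C^1$ up to the boundary: if $f$ extends to a $C^1$ map on $\overline S$, then $f(S)$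 meets $\partial\mathbb B$ transversally, in the same sense, at $f(x)$ for every $x\in\partial S$ with $f(x)\in\partial\mathbb B$. -/

import Mathlib

open scoped Manifold ContDiff

/-- A simple closed analytic curve in a Riemann surface `X`: the image of the unit circle under
an injective holomorphic map defined on an open neighbourhood of the circle in `ℂ`. -/
def IsSimpleClosedAnalyticCurve {X : Type*} [TopologicalSpace X] [ChartedSpace ℂ X]
    (C : Set X) : Prop :=
  ∃ (U : Set ℂ) (γ : ℂ → X), IsOpen U ∧ Metric.sphere (0 : ℂ) 1 ⊆ U ∧
    MDifferentiableOn 𝓘(ℂ, ℂ) 𝓘(ℂ, ℂ) γ U ∧ Set.InjOn γ U ∧ C = γ '' Metric.sphere (0 : ℂ) 1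

/-- `S` is a finite Riemann surface inside the compact one-dimensional complex manifold `X`:
a nonempty open subset, containing no component of `X`, whose boundary is the union of finitely
many pairwise disjoint simple closed analytic curves and is also the boundary of its closure.
Neither `X` nor `S` has to be connected: in general `S` is a finite disjoint union of connected
finite Riemann surfaces. For connected `X` the second condition says that `S ≠ X`. -/
structure IsFiniteRiemannSurface {X : Type*} [TopologicalSpace X] [ChartedSpace ℂ X]
    (S : Set X) : Prop where
  nonempty : S.Nonempty
  isOpen : IsOpen S
  not_component_subset : ∀ x : X, ¬ connectedComponent x ⊆ S
  frontier_closure : frontier (closure S) = frontier S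
  exists_curves : ∃ 𝒞 : Set (Set X), 𝒞.Finite ∧ 𝒞.PairwiseDisjoint id ∧
    (∀ C ∈ 𝒞, IsSimpleClosedAnalyticCurve C) ∧ ⋃₀ 𝒞 = frontier S

/-- The map `f`, regarded on the set `T` (a surface together with one or all of its boundary
points), meets the unit sphere transversally at the boundary point `x`: it has a complex linear
derivative `f'` at `x` relative to `T`, and `⟨f x, f' v⟩ ≠ 0` for each nonzero tangent vector `v`
at `x`. In a local parameter `z` at `x` the vectors `f' v`, `v ≠ 0`, are the nonzero multiples
of `df/dz`, so that this says `⟨f x, df/dz⟩ ≠ 0`. -/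
def MeetsSphereTransversallyAt {X : Type*} [TopologicalSpace X] [ChartedSpace ℂ X]
    {H : Type*} [NormedAddCommGroup H] [InnerProductSpace ℂ H]
    (f : X → H) (T : Set X) (x : X) : Prop :=
  ∃ f' : TangentSpace 𝓘(ℂ, ℂ) x →L[ℂ] H,
    HasMFDerivWithinAt 𝓘(ℂ, ℂ) 𝓘(ℂ, H) f T x f' ∧
      ∀ v : TangentSpace 𝓘(ℂ, ℂ) x, v ≠ 0 → inner ℂ (f x) (f' v) ≠ 0

/-! Transversality is Hopf's boundary point lemma applied to one scalar function. Pairing `f` with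
the unit vector `f x` gives, by Cauchy–Schwarz, a holomorphic map from `S` to the unit disc with
value 1 at `x`. Pull it back along a holomorphic `Γ` sending a disc into `S` and a point `p` of its
circle to `x`. Since the tangent space is a complex line, `⟨f x, f' v⟩ = 0` for a single `v ≠ 0`
makes the derivative of the pullback vanish at `p`. But Schwarz–Pick bounds `1 - |G|` below by a
multiple of the distance to the circle along the radius to `p`, a contradiction.

Two inputs remain. The real derivative at `x` is complex linear as a limit of complex linear ones.
The disc exists because the analytic parametrization straightens the boundary to a real segment, and
`S` fills at least one side of it. -/

/-- A consequence of the Schwarz–Pick inequality: a holomorphic self-map of the unit disc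
approaches the unit circle at most linearly. -/
theorem Complex.exists_mul_le_one_sub_sq_norm {G : ℂ → ℂ}
    (hd : DifferentiableOn ℂ G (Metric.ball 0 1))
    (hm : Set.MapsTo G (Metric.ball 0 1) (Metric.ball 0 1)) :
    ∃ k : ℝ, 0 < k ∧ ∀ z ∈ Metric.ball (0 : ℂ) 1, k * (1 - ‖z‖ ^ 2) ≤ 1 - ‖G z‖ ^ 2 := by
  have hn : ∀ z ∈ Metric.ball (0 : ℂ) 1, ‖G z‖ < 1 := fun z hz => by simpa using hm hz
  set a := G 0 with ha
  have ha1 : ‖a‖ < 1 := hn 0 (by simp)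
  -- The identity behind the disc automorphism sending `a` to 0: it shows that the quotient below
  -- has norm at most 1, and later turns Schwarz's bound into one for `1 - ‖G z‖ ^ 2`.
  have hident : ∀ w : ℂ, ‖1 - (starRingEnd ℂ) a * w‖ ^ 2 - ‖w - a‖ ^ 2
      = (1 - ‖a‖ ^ 2) * (1 - ‖w‖ ^ 2) := by
    intro w
    simp only [Complex.sq_norm, Complex.normSq_apply, Complex.sub_re, Complex.sub_im,
      Complex.mul_re, Complex.mul_im, Complex.conj_re, Complex.conj_im, Complex.one_re,
      Complex.one_im]
    ring
  have hlow : ∀ w : ℂ, ‖w‖ < 1 → 1 - ‖a‖ ≤ ‖1 - (starRingEnd ℂ) a * w‖ := by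
    intro w hw
    have h1 := norm_sub_norm_le (1 : ℂ) ((starRingEnd ℂ) a * w)
    rw [norm_mul, RCLike.norm_conj, norm_one] at h1
    nlinarith [norm_nonneg a, norm_nonneg w]
  have hsq : 0 < 1 - ‖a‖ ^ 2 := by nlinarith [norm_nonneg a]
  refine ⟨(1 - ‖a‖) ^ 2 / (1 - ‖a‖ ^ 2), div_pos (by nlinarith) hsq, fun z hz => ?_⟩
  have hne : ∀ y ∈ Metric.ball (0 : ℂ) 1, 1 - (starRingEnd ℂ) a * G y ≠ 0 := fun y hy h => by
    have := hlow _ (hn y hy)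
    rw [h, norm_zero] at this
    linarith
  have hS : ‖(G z - a) / (1 - (starRingEnd ℂ) a * G z)‖ ≤ ‖z‖ := by
    refine Complex.norm_le_norm_of_mapsTo_ball (R := 1)
      (f := fun y => (G y - a) / (1 - (starRingEnd ℂ) a * G y)) ?_ ?_ ?_ (by simpa using hz)
    · exact (hd.sub_const a).div ((hd.const_mul _).const_sub 1) hne
    · intro y hy
      have h0 := norm_pos_iff.2 (hne y hy)
      rw [mem_closedBall_zero_iff, norm_div, div_le_one h0]
      refine le_of_sq_le_sq ?_ h0.le
      have := hident (G y)
      nlinarith [mul_pos hsq (show 0 < 1 - ‖G y‖ ^ 2 by nlinarith [hn y hy, norm_nonneg (G y)])]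
    · simp [ha]
  have h0 := norm_pos_iff.2 (hne z hz)
  rw [norm_div, div_le_iff₀ h0] at hS
  have h2 : ‖G z - a‖ ^ 2 ≤ (‖z‖ * ‖1 - (starRingEnd ℂ) a * G z‖) ^ 2 :=
    pow_le_pow_left₀ (norm_nonneg _) hS 2
  have h3 : (1 - ‖a‖) ^ 2 ≤ ‖1 - (starRingEnd ℂ) a * G z‖ ^ 2 :=
    pow_le_pow_left₀ (by linarith) (hlow _ (hn z hz)) 2
  have hz1 : 0 ≤ 1 - ‖z‖ ^ 2 := by
    have : ‖z‖ < 1 := by simpa using hz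
    nlinarith [norm_nonneg z]
  rw [div_mul_eq_mul_div, div_le_iff₀ hsq]
  nlinarith [hident (G z), mul_le_mul_of_nonneg_right h3 hz1]

/-- Hopf's boundary point lemma for holomorphic maps into the unit disc. -/
theorem Complex.not_hasFDerivWithinAt_zero_of_mapsTo_ball {G : ℂ → ℂ} {c p : ℂ} {δ : ℝ}
    (hδ : 0 < δ) (hp : dist p c = δ) (hd : DifferentiableOn ℂ G (Metric.ball c δ))
    (hm : Set.MapsTo G (Metric.ball c δ) (Metric.ball 0 1)) (hG : ‖G p‖ = 1) :
    ¬ HasFDerivWithinAt G (0 : ℂ →L[ℂ] ℂ) (insert p (Metric.ball c δ)) p := by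
  intro hF
  have hpc : ‖p - c‖ = δ := by rw [← dist_eq_norm, hp]
  have hmaps : Set.MapsTo (fun z : ℂ => c + z * (p - c)) (Metric.ball 0 1) (Metric.ball c δ) := by
    intro z hz
    have hz' : ‖z‖ < 1 := by simpa using hz
    rw [mem_ball_iff_norm]
    simp only [add_sub_cancel_left, norm_mul, hpc]
    nlinarith
  obtain ⟨k, hk, hkG⟩ := Complex.exists_mul_le_one_sub_sq_norm
    (G := fun z => G (c + z * (p - c)))
    (hd.comp (by fun_prop) hmaps) (hm.comp hmaps)
  -- At `c + t (p - c)` a zero derivative would give `1 - ‖G‖ ≤ k (1 - t) / 4`, while Schwarz–Pick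
  -- gives `1 - ‖G‖ ≥ k (1 - t ^ 2) / 2 > k (1 - t) / 2`.
  have hδk : 0 < k / (4 * δ) := by positivity
  have hlo := hF.isLittleO.def hδk
  have hpath : Filter.Tendsto (fun t : ℝ => c + (t : ℂ) * (p - c)) (nhdsWithin 1 (Set.Ioo 0 1))
      (nhdsWithin p (insert p (Metric.ball c δ))) := by
    refine tendsto_nhdsWithin_iff.2 ⟨?_, ?_⟩
    · have : Continuous fun t : ℝ => c + (t : ℂ) * (p - c) := by fun_prop
      have h := (this.tendsto 1).mono_left (nhdsWithin_le_nhds (s := Set.Ioo 0 1))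
      simpa using h
    · filter_upwards [self_mem_nhdsWithin] with t ht
      refine Or.inr (hmaps ?_)
      simpa [abs_of_pos ht.1] using ht.2
  have hne : (nhdsWithin (1 : ℝ) (Set.Ioo 0 1)).NeBot := by
    rw [← mem_closure_iff_nhdsWithin_neBot, closure_Ioo (by norm_num)]
    simp
  obtain ⟨t, ht, ht'⟩ := ((hpath.eventually hlo).and self_mem_nhdsWithin).exists
  have hdist : ‖c + (t : ℂ) * (p - c) - p‖ = (1 - t) * δ := by
    have : c + (t : ℂ) * (p - c) - p = ((t - 1 : ℝ) : ℂ) * (p - c) := by push_cast; ring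
    rw [this, norm_mul, hpc, Complex.norm_real, Real.norm_eq_abs, abs_of_neg (by linarith [ht'.2])]
    ring
  rw [hdist] at ht
  have hkt := hkG t (by simpa [abs_of_pos ht'.1] using ht'.2)
  simp only [Complex.norm_real, Real.norm_eq_abs, abs_of_pos ht'.1] at hkt
  simp only [zero_apply, sub_zero] at ht
  have h1 := norm_sub_norm_le (G p) (G (c + t * (p - c)))
  rw [hG, norm_sub_rev] at h1
  have h2 : k / (4 * δ) * ((1 - t) * δ) = k * (1 - t) / 4 := by field_simp
  rw [h2] at ht
  have h3 : ‖G (c + t * (p - c))‖ < 1 := by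
    simpa using hm (hmaps (show (t : ℂ) ∈ Metric.ball (0 : ℂ) 1 by
      simpa [abs_of_pos ht'.1] using ht'.2))
  nlinarith [ht'.1, ht'.2, mul_pos hk (sub_pos.2 ht'.2), norm_nonneg (G (c + t * (p - c))),
    mul_pos (mul_pos hk (sub_pos.2 ht'.2)) ht'.1]

/-- A map which is real `C¹` on a set `T` up to a limit point of an open subset of `T` on which it
is holomorphic has a complex linear derivative there. -/
theorem ContDiffWithinAt.exists_complex_hasFDerivWithinAt {E F : Type*}
    [NormedAddCommGroup E] [NormedSpace ℂ E] [NormedAddCommGroup F] [NormedSpace ℂ F]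
    {f : E → F} {T W : Set E} {q : E} (hf : ContDiffWithinAt ℝ 1 f T q) (hW : IsOpen W)
    (hWT : W ⊆ T) (hd : DifferentiableOn ℂ f W) (hq : q ∈ closure W) :
    ∃ L : E →L[ℂ] F, HasFDerivWithinAt f L T q := by
  obtain ⟨u, hu, -, f', hf', hc⟩ :=
    (contDiffWithinAt_succ_iff_hasFDerivWithinAt (n := 0) (by simp)).1 (by simpa using hf)
  have hqu : q ∈ u := mem_of_mem_nhdsWithin (Set.mem_insert q T) hu
  have hlin : ∀ᶠ y in nhdsWithin q W, ∀ v : E, f' y (Complex.I • v) = Complex.I • f' y v := by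
    have hu' : u ∈ nhdsWithin q W := nhdsWithin_mono q (hWT.trans (Set.subset_insert q T)) hu
    filter_upwards [eventually_eventually_nhdsWithin.2 hu', self_mem_nhdsWithin] with y hy hyW v
    rw [hW.nhdsWithin_eq hyW] at hy
    have h1 : HasFDerivAt f (f' y) y := (hf' y (mem_of_mem_nhds hy)).hasFDerivAt hy
    have h2 := ((hd y hyW).differentiableAt (hW.mem_nhds hyW)).hasFDerivAt
    have h3 := h1.unique (h2.restrictScalars ℝ)
    rw [h3]
    simp
  have hcont : Filter.Tendsto f' (nhdsWithin q W) (nhds (f' q)) := by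
    have h := hc.continuousWithinAt
    refine h.mono_left ?_
    rw [nhdsWithin_le_iff]
    exact nhdsWithin_mono q (hWT.trans (Set.subset_insert q T)) hu
  have hne : (nhdsWithin q W).NeBot := mem_closure_iff_nhdsWithin_neBot.1 hq
  -- Commuting with `I` passes to the limit along `W`, by continuity of the real derivative.
  have hI : ∀ v : E, f' q (Complex.I • v) = Complex.I • f' q v := by
    intro v
    have eval : ∀ w : E, Filter.Tendsto (fun y => f' y w) (nhdsWithin q W) (nhds (f' q w)) :=
      fun w => ((ContinuousLinearMap.apply ℝ F w).continuous.tendsto _).comp hcont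
    have e1 := eval (Complex.I • v)
    have e2 := (eval v).const_smul Complex.I
    exact tendsto_nhds_unique_of_eventuallyEq e1 e2 (hlin.mono fun y hy => hy v)
  let L : E →L[ℂ] F :=
    { toFun := f' q
      map_add' := map_add _
      map_smul' := fun z v => by
        have hz : z • v = z.re • v + z.im • (Complex.I • v) := by
          conv_lhs => rw [← Complex.re_add_im z]
          rw [add_smul, mul_smul, Complex.coe_smul, Complex.coe_smul]
        have hz' : z • f' q v = z.re • f' q v + z.im • (Complex.I • f' q v) := by
          conv_lhs => rw [← Complex.re_add_im z]
          rw [add_smul, mul_smul, Complex.coe_smul, Complex.coe_smul]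
        simp only [RingHom.id_apply]
        rw [hz, map_add, map_smul, map_smul, hI, hz']
      cont := (f' q).continuous }
  refine ⟨L, HasFDerivWithinAt.of_restrictScalars ℝ (g' := f' q) ?_ rfl⟩
  exact ((hf' q hqu).mono_of_mem_nhdsWithin hu).mono (Set.subset_insert q T)

/-- At a boundary point of a finite Riemann surface there is a map, holomorphic on an open disc
and at a point of its boundary circle, that sends the open disc into the surface and that boundary point
to the given point. -/
theorem IsFiniteRiemannSurface.exists_inner_disc {X : Type*} [TopologicalSpace X] [T2Space X]
    [ChartedSpace ℂ X] [IsManifold 𝓘(ℂ, ℂ) ω X] {S : Set X} (hS : IsFiniteRiemannSurface S)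
    {x₀ : X} (hx₀ : x₀ ∈ frontier S) :
    ∃ (Γ : ℂ → X) (c p : ℂ) (δ : ℝ), 0 < δ ∧ dist p c = δ ∧ Γ p = x₀ ∧
      MDifferentiableAt 𝓘(ℂ, ℂ) 𝓘(ℂ, ℂ) Γ p ∧
      (∀ z ∈ Metric.ball c δ, MDifferentiableAt 𝓘(ℂ, ℂ) 𝓘(ℂ, ℂ) Γ z) ∧
      Set.MapsTo Γ (Metric.ball c δ) S := by
  obtain ⟨𝒞, hfin, hdisj, hcurve, hunion⟩ := hS.exists_curves
  rw [← hunion] at hx₀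
  obtain ⟨C, hC, hxC⟩ := hx₀
  obtain ⟨U, γ, hU, hsU, hγ, hinj, rfl⟩ := hcurve C hC
  obtain ⟨p, hp, rfl⟩ := hxC
  have hpn : ‖p‖ = 1 := by simpa using hp
  set C := γ '' Metric.sphere (0 : ℂ) 1 with hCdef
  have hclosed : ∀ D ∈ 𝒞, IsClosed D := by
    intro D hD
    obtain ⟨V, η, hV, hsV, hη, -, rfl⟩ := hcurve D hD
    exact ((isCompact_sphere _ _).image_of_continuousOn (hη.continuousOn.mono hsV)).isClosed
  -- The other curves form a closed set missing `γ p`, so near it the boundary is `C` alone.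
  set K := ⋃₀ (𝒞 \ {C}) with hK
  have hKc : IsClosed K := by
    rw [hK, Set.sUnion_eq_biUnion]
    exact (hfin.subset Set.sdiff_subset).isClosed_biUnion fun D hD => hclosed D hD.1
  have hxK : γ p ∉ K := by
    rintro ⟨D, ⟨hD, hDC⟩, hxD⟩
    exact Set.disjoint_left.1 (hdisj hD hC hDC) hxD ⟨p, hp, rfl⟩
  -- In this coordinate the circle is exactly `im w = 0`.
  let e : ℂ → ℂ := fun w => p * Complex.exp (Complex.I * w)
  have he : Differentiable ℂ e := by fun_prop
  have he0 : e 0 = p := by simp [e]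
  have hen : ∀ w, ‖e w‖ = Real.exp (-w.im) := by
    intro w
    simp [e, hpn, Complex.norm_exp]
  have heim : ∀ w, e w ∈ Metric.sphere (0 : ℂ) 1 ↔ w.im = 0 := by
    intro w
    rw [mem_sphere_zero_iff_norm, hen, Real.exp_eq_one_iff, neg_eq_zero]
  let Γ : ℂ → X := fun w => γ (e w)
  have hU' : IsOpen (e ⁻¹' U) := hU.preimage he.continuous
  have h0U : (0 : ℂ) ∈ e ⁻¹' U := by
    show e 0 ∈ U
    rw [he0]
    exact hsU hp
  have hΓ : ∀ w ∈ e ⁻¹' U, MDifferentiableAt 𝓘(ℂ, ℂ) 𝓘(ℂ, ℂ) Γ w := fun w hw =>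
    ((hγ (e w) hw).mdifferentiableAt (hU.mem_nhds hw)).comp w (he w).mdifferentiableAt
  have hΓ0 : Γ 0 = γ p := congrArg γ he0
  set φ := chartAt ℂ (γ p) with hφ
  have hev : ∀ᶠ w in nhds (0 : ℂ), w ∈ e ⁻¹' U ∧ Γ w ∈ Kᶜ ∩ φ.source := by
    refine (hU'.eventually_mem h0U).and ((hΓ 0 h0U).continuousAt.eventually_mem ?_)
    rw [hΓ0]
    exact (hKc.isOpen_compl.inter φ.open_source).mem_nhds ⟨hxK, mem_chart_source ℂ (γ p)⟩
  obtain ⟨r, hr, hball⟩ := Metric.eventually_nhds_iff_ball.1 hev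
  have hfront : ∀ w ∈ Metric.ball (0 : ℂ) r, Γ w ∈ frontier S ↔ w.im = 0 := by
    intro w hw
    obtain ⟨hwU, hwK, -⟩ := hball w hw
    rw [← heim w, ← hunion]
    constructor
    · rintro ⟨D, hD, hwD⟩
      by_cases hDC : D = C
      · rw [hDC] at hwD
        obtain ⟨s, hs, hse⟩ := hwD
        rwa [← hinj (hsU hs) hwU hse]
      · exact absurd ⟨D, ⟨hD, hDC⟩, hwD⟩ hwK
    · exact fun h => ⟨C, hC, ⟨e w, h, rfl⟩⟩
  have hgd : DifferentiableOn ℂ (fun w => φ (Γ w)) (Metric.ball 0 r) := by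
    intro w hw
    have h1 : MDifferentiableAt 𝓘(ℂ, ℂ) 𝓘(ℂ, ℂ) φ (Γ w) :=
      mdifferentiableAt_atlas (chart_mem_atlas ℂ (γ p)) (hball w hw).2.2
    exact (mdifferentiableAt_iff_differentiableAt.1
      (h1.comp w (hΓ w (hball w hw).1))).differentiableWithinAt
  have hga : AnalyticAt ℂ (fun w => φ (Γ w)) 0 :=
    hgd.analyticAt (Metric.ball_mem_nhds 0 hr)
  -- The open mapping theorem ensures that `Γ` hits points of `S` near 0; the constant case
  -- contradicts injectivity of `γ` at a point off the real axis.
  have hopen : nhds (φ (Γ 0)) ≤ Filter.map (fun w => φ (Γ w)) (nhds 0) := by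
    refine hga.eventually_constant_or_nhds_le_map_nhds.resolve_left fun hconst => ?_
    obtain ⟨ρ, hρ, hρc⟩ := Metric.eventually_nhds_iff_ball.1
      (hconst.and (Metric.ball_mem_nhds (0 : ℂ) hr))
    have hmem : Complex.I * (ρ / 2 : ℝ) ∈ Metric.ball (0 : ℂ) ρ := by
      rw [mem_ball_zero_iff, norm_mul, Complex.norm_I, one_mul, Complex.norm_real,
        Real.norm_of_nonneg (by positivity)]
      linarith
    obtain ⟨h1, h2⟩ := hρc _ hmem
    have h3 := φ.injOn (hball _ h2).2.2 (hball 0 (Metric.mem_ball_self hr)).2.2 h1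
    have h4 := hinj (hball _ h2).1 h0U h3
    have h5 := (heim (Complex.I * (ρ / 2 : ℝ))).1 (by rw [h4, he0]; exact hp)
    rw [Complex.I_mul_im, Complex.ofReal_re] at h5
    linarith
  obtain ⟨w, hw, hwS⟩ : ∃ w ∈ Metric.ball (0 : ℂ) r, Γ w ∈ S := by
    have hx : γ p ∈ closure S := frontier_subset_closure (hunion ▸ ⟨C, hC, ⟨p, hp, rfl⟩⟩)
    have h1 : (fun w => φ (Γ w)) '' Metric.ball 0 r ∈ nhds (φ (γ p)) := by
      rw [← hΓ0]
      exact hopen (Filter.image_mem_map (Metric.ball_mem_nhds 0 hr))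
    have h2 := (φ.continuousAt (mem_chart_source ℂ (γ p))).preimage_mem_nhds h1
    obtain ⟨y, ⟨⟨w, hw, hwy⟩, hys⟩, hyS⟩ := mem_closure_iff_nhds.1 hx _
      (Filter.inter_mem h2 (φ.open_source.mem_nhds (mem_chart_source ℂ (γ p))))
    exact ⟨w, hw, by rwa [φ.injOn (hball w hw).2.2 hys hwy]⟩
  have hwim : w.im ≠ 0 := fun h =>
    Set.disjoint_left.1 (disjoint_frontier_iff_isOpen.2 hS.isOpen) ((hfront w hw).2 h) hwS
  -- The connected set `Γ '' A` meets `S` but not its frontier, so it stays in `S`.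
  have hside : ∀ A ⊆ Metric.ball (0 : ℂ) r, Convex ℝ A → (∀ z ∈ A, z.im ≠ 0) → w ∈ A →
      Set.MapsTo Γ A S := by
    intro A hA hconv him hwA
    have hpre : IsPreconnected (Γ '' A) := hconv.isPreconnected.image Γ fun z hz =>
      (hΓ z (hball z (hA hz)).1).continuousAt.continuousWithinAt
    refine Set.mapsTo_iff_image_subset.2 (hpre.subset_of_closure_inter_subset hS.isOpen
      ⟨Γ w, ⟨w, hwA, rfl⟩, hwS⟩ ?_)
    rintro _ ⟨hcl, z, hz, rfl⟩
    by_contra hzS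
    refine him z hz ((hfront z (hA hz)).1 ?_)
    rw [hS.isOpen.frontier_eq]
    exact ⟨hcl, hzS⟩
  -- Here `s` is the sign of `w.im`; the disc lies in the half disc containing `w`, tangent to the
  -- real axis at 0.
  have hdisc : ∀ s : ℝ, |s| = 1 → 0 < s * w.im → ∃ c : ℂ, dist 0 c = r / 2 ∧
      Metric.ball c (r / 2) ⊆ Metric.ball 0 r ∧ Set.MapsTo Γ (Metric.ball c (r / 2)) S := by
    intro s hs hsw
    have hcn : ‖Complex.I * ((s * (r / 2) : ℝ) : ℂ)‖ = r / 2 := by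
      rw [norm_mul, Complex.norm_I, one_mul, Complex.norm_real, Real.norm_eq_abs, abs_mul, hs,
        one_mul, abs_of_pos (by positivity)]
    have hsub : Metric.ball (Complex.I * ((s * (r / 2) : ℝ) : ℂ)) (r / 2) ⊆ Metric.ball 0 r :=
      Metric.ball_subset_ball' (by rw [dist_zero_right, hcn]; linarith)
    refine ⟨Complex.I * ((s * (r / 2) : ℝ) : ℂ), by rw [dist_zero_left, hcn], hsub, ?_⟩
    refine (hside (Metric.ball 0 r ∩ {z | 0 < s * z.im}) Set.inter_subset_left
      ((convex_ball 0 r).inter ?_) ?_ ⟨hw, hsw⟩).mono_left fun z hz => ⟨hsub hz, ?_⟩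
    · exact convex_halfSpace_gt (f := fun z : ℂ => s * z.im)
        ⟨fun x y => by simp [mul_add], fun a x => by simp; ring⟩ 0
    · rintro z ⟨-, hz⟩ h0
      simp [h0] at hz
    · have h1 := (Complex.abs_im_le_norm _).trans_lt (mem_ball_iff_norm.1 hz)
      rw [Complex.sub_im, Complex.I_mul_im, Complex.ofReal_re] at h1
      have h2 : |s * z.im - r / 2| < r / 2 := by
        have hss : s * s = 1 := by rw [← abs_mul_abs_self, hs, one_mul]
        have : s * z.im - r / 2 = s * (z.im - s * (r / 2)) := by linear_combination (r / 2) * hss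
        rwa [this, abs_mul, hs, one_mul]
      show 0 < s * z.im
      linarith [(abs_lt.1 h2).1]
  obtain ⟨c, hc1, hc2, hc3⟩ : ∃ c : ℂ, dist 0 c = r / 2 ∧
      Metric.ball c (r / 2) ⊆ Metric.ball 0 r ∧ Set.MapsTo Γ (Metric.ball c (r / 2)) S := by
    rcases lt_or_gt_of_ne hwim with h | h
    · exact hdisc (-1) (by simp) (by linarith)
    · exact hdisc 1 (by simp) (by linarith)
  exact ⟨Γ, c, 0, r / 2, half_pos hr, hc1, hΓ0, hΓ 0 h0U,
    fun z hz => hΓ z (hball z (hc2 hz)).1, hc3⟩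

/-- A map on a Riemann surface which is real `C¹` on a set `T` up to a limit point of an open subset
of `T` on which it is holomorphic has a complex linear derivative there. -/
theorem ContMDiffWithinAt.exists_complex_hasMFDerivWithinAt {X : Type*} [TopologicalSpace X]
    [ChartedSpace ℂ X] [IsManifold 𝓘(ℂ, ℂ) ω X] {H : Type*} [NormedAddCommGroup H]
    [NormedSpace ℂ H] {f : X → H} {S T : Set X} {x : X}
    (hf : ContMDiffWithinAt 𝓘(ℝ, ℂ) 𝓘(ℝ, H) 1 f T x) (hS : IsOpen S) (hST : S ⊆ T)
    (hd : MDifferentiableOn 𝓘(ℂ, ℂ) 𝓘(ℂ, H) f S) (hx : x ∈ closure S) :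
    ∃ f' : TangentSpace 𝓘(ℂ, ℂ) x →L[ℂ] H, HasMFDerivWithinAt 𝓘(ℂ, ℂ) 𝓘(ℂ, H) f T x f' := by
  set φ := chartAt ℂ x with hφ
  have hxs : x ∈ φ.source := mem_chart_source ℂ x
  have hW : IsOpen (φ.target ∩ φ.symm ⁻¹' S) := φ.isOpen_inter_preimage_symm hS
  have hdW : DifferentiableOn ℂ (fun z => f (φ.symm z)) (φ.target ∩ φ.symm ⁻¹' S) := by
    rintro z ⟨hzt, hzS⟩
    have h1 : MDifferentiableAt 𝓘(ℂ, ℂ) 𝓘(ℂ, ℂ) φ.symm z :=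
      mdifferentiableAt_atlas_symm (chart_mem_atlas ℂ x) hzt
    have h2 : MDifferentiableAt 𝓘(ℂ, ℂ) 𝓘(ℂ, H) f (φ.symm z) :=
      (hd _ hzS).mdifferentiableAt (hS.mem_nhds hzS)
    exact (mdifferentiableAt_iff_differentiableAt.1 (h2.comp z h1)).differentiableWithinAt
  have hq : φ x ∈ closure (φ.target ∩ φ.symm ⁻¹' S) := by
    rw [mem_closure_iff_nhds]
    intro V hV
    obtain ⟨y, ⟨hyV, hys⟩, hyS⟩ := mem_closure_iff_nhds.1 hx _
      (Filter.inter_mem ((φ.continuousAt hxs).preimage_mem_nhds hV) (φ.open_source.mem_nhds hxs))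
    exact ⟨φ y, hyV, φ.map_source hys, by simpa [φ.left_inv hys] using hyS⟩
  have hc := (contMDiffWithinAt_iff.1 hf).2
  simp only [mfld_simps] at hc
  obtain ⟨L, hL⟩ := ContDiffWithinAt.exists_complex_hasFDerivWithinAt (W := φ.target ∩ φ.symm ⁻¹' S)
    hc hW (fun z hz => hST hz.2) hdW hq
  refine ⟨L, hf.continuousWithinAt, ?_⟩
  simp only [mfld_simps]
  exact hL

/-- A holomorphic map from a finite Riemann surface to the unit ball which is `C¹` up to a boundary
point that it sends to the unit sphere meets the sphere transversally there. -/
theorem IsFiniteRiemannSurface.meetsSphereTransversallyAt {X : Type*} [TopologicalSpace X]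
    [T2Space X] [ChartedSpace ℂ X] [IsManifold 𝓘(ℂ, ℂ) ω X] {H : Type*} [NormedAddCommGroup H]
    [InnerProductSpace ℂ H] {S T : Set X} (hS : IsFiniteRiemannSurface S) {f : X → H}
    (hf : MDifferentiableOn 𝓘(ℂ, ℂ) 𝓘(ℂ, H) f S) (hfS : Set.MapsTo f S (Metric.ball (0 : H) 1))
    (hST : S ⊆ T) {x : X} (hx : x ∈ frontier S) (hxT : x ∈ T)
    (hfT : ContMDiffWithinAt 𝓘(ℝ, ℂ) 𝓘(ℝ, H) 1 f T x) (hfx : f x ∈ Metric.sphere (0 : H) 1) :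
    MeetsSphereTransversallyAt f T x := by
  obtain ⟨f', hf'⟩ :=
    hfT.exists_complex_hasMFDerivWithinAt hS.isOpen hST hf (frontier_subset_closure hx)
  refine ⟨f', hf', fun v hv h0 => ?_⟩
  have hzero : ∀ u : TangentSpace 𝓘(ℂ, ℂ) x, inner ℂ (f x) (f' u) = 0 := by
    intro u
    let v' : ℂ := v
    let u' : ℂ := u
    have hu : u = (u' / v') • v := (div_mul_cancel₀ u' (show v' ≠ 0 from hv)).symm
    rw [hu, map_smul, inner_smul_right, h0, mul_zero]
  have hfn : ‖f x‖ = 1 := by simpa using hfx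
  obtain ⟨Γ, c, p, δ, hδ, hp, rfl, hΓp, hΓ, hΓS⟩ := hS.exists_inner_disc hx
  have hfΓ : ∀ z ∈ Metric.ball c δ, DifferentiableAt ℂ (fun z => f (Γ z)) z := fun z hz =>
    mdifferentiableAt_iff_differentiableAt.1
      (((hf _ (hΓS hz)).mdifferentiableAt (hS.isOpen.mem_nhds (hΓS hz))).comp z (hΓ z hz))
  refine Complex.not_hasFDerivWithinAt_zero_of_mapsTo_ball
    (G := fun z => innerSL ℂ (f (Γ p)) (f (Γ z))) hδ hp ?_ ?_ ?_ ?_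
  · exact fun z hz => ((innerSL ℂ (f (Γ p))).differentiableAt.comp z
      (hfΓ z hz)).differentiableWithinAt
  · intro z hz
    have h1 : ‖f (Γ z)‖ < 1 := by simpa using hfS (hΓS hz)
    rw [mem_ball_zero_iff]
    show ‖inner ℂ (f (Γ p)) (f (Γ z))‖ < 1
    refine (norm_inner_le_norm _ _).trans_lt ?_
    rwa [hfn, one_mul]
  · simp [inner_self_eq_norm_sq_to_K, hfn]
  · have hmaps : insert p (Metric.ball c δ) ⊆ Γ ⁻¹' T := by
      rintro z (rfl | hz)
      · exact hxT
      · exact hST (hΓS hz)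
    have h1 : HasFDerivWithinAt (fun z => f (Γ z)) _ (insert p (Metric.ball c δ)) p :=
      (hf'.comp p hΓp.hasMFDerivAt.hasMFDerivWithinAt hmaps).hasFDerivWithinAt
    have h2 := (innerSL ℂ (f (Γ p))).hasFDerivAt.comp_hasFDerivWithinAt p h1
    refine h2.congr_fderiv ?_
    -- The derivative of `Γ` at `p` need not be nonzero: the pairing kills every tangent vector.
    ext
    exact hzero _

theorem mainTheorem8
    {X : Type*} [TopologicalSpace X] [T2Space X] [CompactSpace X]
    [ChartedSpace ℂ X] [IsManifold 𝓘(ℂ, ℂ) ω X]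
    {H : Type*} [NormedAddCommGroup H] [InnerProductSpace ℂ H] [CompleteSpace H]
    (S : Set X) (hS : IsFiniteRiemannSurface S)
    (f : X → H) (hf : MDifferentiableOn 𝓘(ℂ, ℂ) 𝓘(ℂ, H) f S)
    (hfS : Set.MapsTo f S (Metric.ball (0 : H) 1)) :
    (∀ x₀ ∈ frontier S,
      ContMDiffOn 𝓘(ℝ, ℂ) 𝓘(ℝ, H) 1 f (S ∪ {x₀}) →
      f x₀ ∈ Metric.sphere (0 : H) 1 →
      MeetsSphereTransversallyAt f (S ∪ {x₀}) x₀) ∧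
    (ContMDiffOn 𝓘(ℝ, ℂ) 𝓘(ℝ, H) 1 f (closure S) →
      ∀ x ∈ frontier S, f x ∈ Metric.sphere (0 : H) 1 →
      MeetsSphereTransversallyAt f (closure S) x) := by
  refine ⟨fun x₀ hx₀ hC hfx => ?_, fun hC x hx hfx => ?_⟩
  · have hmem : x₀ ∈ S ∪ {x₀} := Or.inr rfl
    exact hS.meetsSphereTransversallyAt hf hfS Set.subset_union_left hx₀ hmem (hC x₀ hmem) hfx
  · have hmem : x ∈ closure S := frontier_subset_closure hx
    exact hS.meetsSphereTransversallyAt hf hfS subset_closure hx hmem (hC x hmem) hfx
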